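/- Let $\Delta$ be a finite abstract simplicial complex on the vertex set $[n]=\{1,\dots,n\}$, with the empty set as its only face of dimension $-1$. Let $d=\dim\Delta$. For $i\in\mathbb Z$ let $\Delta_i$ be the set of $i$-dimensional faces, $f_i(\Delta)=|\Delta_i|$, $C_i(\Delta)=\mathbb Z\Delta_i$ the group of integral $i$-chains, $\partial_i\colon C_i(\Delta)\to C_{i-1}(\Delta)$ the boundary map with respect to the orientation given by the natural order of $[n]$, $\widetilde H_i(\Delta)=\ker\partial_i/\operatorname{im}\partial_{i+1}$ the reduced integral homology, $\tilde\beta_i(\Delta)$ its rank, $\mathbf T(\cdot)$ the torsion subgroup of an abelian group, and $\mathrm{Skel}_i(\Delta)$ the subcomplex of all faces of dimension at most $i$. *Dollar game and degree.* Let $L_i=\partial_{i+1}\partial_{i+1}^t\colon C_i(\Delta)\to C_i(\Delta)$. An $i$-chain $\sigma$ is *winnable* if there is $v\in C_i(\Delta)$ such that $\sigma+L_iv$ has only nonnegative coefficients. Let $\ker^+L_i$ be the monoid of those chains in $\ker L_i$ all of whose coefficients are nonnegative, and let $\mathcal H_i=(h_1,\dots,h_\ell)$ be its Hilbert basis, i.e.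 the nonzero elements of $\ker^+L_i$ that are not the sum of two nonzero elements of $\ker^+L_i$. The *degree* of $\sigma\in C_i(\Delta)$ is the integer vector $\deg(\sigma)=(\sigma\cdot h_1,\dots,\sigma\cdot h_\ell)$, where $\sigma\cdot h=\sum_{f\in\Delta_i}\sigma(f)h(f)$. *Forests.* A *spanning $i$-forest* of $\Delta$ is an $i$-dimensional subcomplex $\Upsilon\subseteq\Delta$ with $\mathrm{Skel}_{i-1}(\Upsilon)=\mathrm{Skel}_{i-1}(\Delta)$, $\widetilde H_i(\Upsilon)=0$, $\tilde\beta_{i-1}(\Upsilon)=\tilde\beta_{i-1}(\Delta)$ and $f_i(\Upsilon)=f_i(\Delta)-\tilde\beta_i(\mathrm{Skel}_i(\Delta))$. The *$i$-forest number* of $\Delta$ is $\tau_i(\Delta)=\sum_\Upsilon|\mathbf T(\widetilde H_{i-1}(\Upsilon))|^2$, the sum over all spanning $i$-forests $\Upsilon$ of $\Delta$. **Statement.** (1) If $1\le i\le d$, then every $(i-1)$-chain of degree $0$ on $\Delta$ is winnable if and only if $\tau_i(\Delta)=1$. (2) For every integer $i$, $\tau_i(\Delta)=1$ if and only if $\mathrm{Skel}_i(\Delta)$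 is a spanning $i$-forest of $\Delta$ and $\widetilde H_{i-1}(\Delta)$ is torsion-free. In particular, for $1\le i\le d$, every $(i-1)$-chain of degree $0$ on $\Delta$ is winnable if and only if $\mathrm{Skel}_i(\Delta)$ is a spanning $i$-forest of $\Delta$ and $\widetilde H_{i-1}(\Delta)$ is torsion-free. -/

import Mathlib

noncomputable section

namespace DollarGame

open Finset

/-! ### Simplicial complexes on `[n]`, chains and boundary maps

Mathlib's `PreAbstractSimplicialComplex` records only the nonempty faces. As usual for reduced
homology the empty set is counted as the single face of dimension `-1` of every complex. -/

variable {n : ℕ}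

/-- The set `Δ_i` of `i`-dimensional faces, `i ∈ ℤ`: the faces with `i + 1` vertices, where the
empty set is the only face of dimension `-1`. -/
abbrev Face (Δ : PreAbstractSimplicialComplex (Fin n)) (i : ℤ) : Type :=
  {s : Finset (Fin n) // (s ∈ Δ ∨ s = ∅) ∧ (s.card : ℤ) = i + 1}

instance (Δ : PreAbstractSimplicialComplex (Fin n)) (i : ℤ) : Fintype (Face Δ i) :=
  Fintype.ofFinite _

instance : Finite (PreAbstractSimplicialComplex (Fin n)) :=
  Finite.of_injective (fun Δ => Δ.faces) fun _ _ h => PreAbstractSimplicialComplex.ext h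

instance : Fintype (PreAbstractSimplicialComplex (Fin n)) := Fintype.ofFinite _

/-- The dimension of a complex (`-1` if its only face is the empty set). -/
def dim (Δ : PreAbstractSimplicialComplex (Fin n)) : ℤ :=
  ((Set.toFinite Δ.faces).toFinset.sup Finset.card : ℕ) - 1

/-- The `i`-skeleton: all faces of dimension at most `i`. -/
def skel (Δ : PreAbstractSimplicialComplex (Fin n)) (i : ℤ) :
    PreAbstractSimplicialComplex (Fin n) where
  faces := {s | s ∈ Δ ∧ (s.card : ℤ) ≤ i + 1}
  isRelLowerSet_faces := by
    rintro s ⟨hs, hc⟩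
    refine ⟨(Δ.isRelLowerSet_faces hs).1, fun t hts ht => ?_⟩
    refine ⟨(Δ.isRelLowerSet_faces hs).2 hts ht, le_trans ?_ hc⟩
    exact_mod_cast Finset.card_le_card hts

/-- The number `f_i` of `i`-faces. -/
def numFaces (Δ : PreAbstractSimplicialComplex (Fin n)) (i : ℤ) : ℕ := Fintype.card (Face Δ i)

/-- Integral `i`-chains `C_i(Δ)`, in coordinates with respect to the basis of `i`-faces; they carry
the component-wise partial order. -/
abbrev Chain (Δ : PreAbstractSimplicialComplex (Fin n)) (i : ℤ) : Type := Face Δ i → ℤ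

/-- The coefficient of `g` in the boundary of the face `f = {v₀ < ⋯ < v_i}`, that is, in
`∑ⱼ (-1)^j (f \ {v_j})`; the index of a vertex `v` of `f` is the number of smaller vertices. -/
def incidence (g f : Finset (Fin n)) : ℤ :=
  ∑ v ∈ f, if f.erase v = g then (-1) ^ (f.filter (· < v)).card else 0

/-- The matrix of the boundary map from `i`-chains to `j`-chains. It is used for `j = i - 1`
(written in whichever form is convenient); for all other `j` it is zero. -/
def boundaryMatrix (Δ : PreAbstractSimplicialComplex (Fin n)) (i j : ℤ) :
    Matrix (Face Δ j) (Face Δ i) ℤ :=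
  Matrix.of fun g f => incidence g.1 f.1

/-- The boundary map `∂_i : C_i(Δ) → C_j(Δ)`, where `j = i - 1`. -/
def boundary (Δ : PreAbstractSimplicialComplex (Fin n)) (i j : ℤ) :
    Chain Δ i →ₗ[ℤ] Chain Δ j :=
  (boundaryMatrix Δ i j).mulVecLin

/-- The transpose `∂_iᵗ : C_j(Δ) → C_i(Δ)`, where `j = i - 1`. -/
def boundaryTranspose (Δ : PreAbstractSimplicialComplex (Fin n)) (i j : ℤ) :
    Chain Δ j →ₗ[ℤ] Chain Δ i :=
  (boundaryMatrix Δ i j).transpose.mulVecLin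

/-- `∂_{i-1} ∂_i = 0`. -/
theorem boundary_comp_boundary (Δ : PreAbstractSimplicialComplex (Fin n)) (i j k : ℤ) :
    boundary Δ j k ∘ₗ boundary Δ i j = 0 := by
  have key : boundaryMatrix Δ j k * boundaryMatrix Δ i j = 0 := by
    ext ⟨h, hh, hhc⟩ ⟨f, hf, hfc⟩
    simp only [Matrix.mul_apply, boundaryMatrix, Matrix.of_apply, Matrix.zero_apply]
    by_cases hij : j = i - 1
    swap
    · refine Finset.sum_eq_zero fun g _ => ?_
      have : incidence g.1 f = 0 := by
        refine Finset.sum_eq_zero fun v hv => if_neg fun he => hij ?_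
        have h1 := g.2.2
        have h2 := Finset.card_erase_add_one hv
        rw [he] at h2
        omega
      rw [this, mul_zero]
    have h1 : ∀ g : Face Δ j, incidence h g.1 * incidence g.1 f =
        ∑ v ∈ f, if f.erase v = g.1 then
          incidence h (f.erase v) * (-1) ^ (f.filter (· < v)).card else 0 := by
      intro g
      conv_lhs => rw [incidence.eq_def g.1 f, Finset.mul_sum]
      refine Finset.sum_congr rfl fun v _ => ?_
      split_ifs with he
      · rw [he]
      · rw [mul_zero]
    rw [Finset.sum_congr rfl fun g _ => h1 g, Finset.sum_comm]
    have h2 : ∀ v ∈ f, (∑ g : Face Δ j, if f.erase v = g.1 then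
        incidence h (f.erase v) * (-1) ^ (f.filter (· < v)).card else 0) =
        ∑ w ∈ f.erase v, if (f.erase v).erase w = h then
          (-1) ^ ((f.erase v).filter (· < w)).card * (-1) ^ (f.filter (· < v)).card else 0 := by
      intro v hv
      have hc := Finset.card_erase_add_one hv
      have hmem : f.erase v ∈ Δ ∨ f.erase v = ∅ := by
        by_cases he : f.erase v = ∅
        · exact Or.inr he
        · rcases hf with hf | hf
          · exact Or.inl ((Δ.isRelLowerSet_faces hf).2 (Finset.erase_subset _ _)
              (Finset.nonempty_iff_ne_empty.2 he))
          · simp [hf] at hv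
      let g₀ : Face Δ j := ⟨f.erase v, hmem, by omega⟩
      rw [Finset.sum_eq_single g₀]
      · rw [if_pos rfl, incidence, Finset.sum_mul]
        refine Finset.sum_congr rfl fun w _ => ?_
        split_ifs <;> simp
      · intro g _ hg
        exact if_neg fun he => hg (Subtype.ext he.symm)
      · simp
    rw [Finset.sum_congr rfl h2, Finset.sum_sigma']
    have lt_case : ∀ v ∈ f, ∀ w ∈ f, w < v →
        (-1 : ℤ) ^ ((f.erase v).filter (· < w)).card * (-1) ^ (f.filter (· < v)).card +
        (-1) ^ ((f.erase w).filter (· < v)).card * (-1) ^ (f.filter (· < w)).card = 0 := by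
      intro v hv w hw hwv
      have e1 : (f.erase v).filter (· < w) = f.filter (· < w) := by
        ext x; simp only [Finset.mem_filter, Finset.mem_erase]
        exact ⟨fun hx => ⟨hx.1.2, hx.2⟩, fun hx => ⟨⟨(hx.2.trans hwv).ne, hx.1⟩, hx.2⟩⟩
      have e2 : (f.erase w).filter (· < v) = (f.filter (· < v)).erase w := by
        ext x; simp only [Finset.mem_filter, Finset.mem_erase]; tauto
      have e3 := Finset.card_erase_add_one (s := f.filter (· < v)) (a := w) (by simp [hw, hwv])
      rw [e1, e2, ← e3]
      ring
    refine Finset.sum_involution (fun x _ => ⟨x.2, x.1⟩) ?_ ?_ ?_ ?_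
    · rintro ⟨v, w⟩ hx
      simp only [Finset.mem_sigma, Finset.mem_erase] at hx
      obtain ⟨hv, hne, hw⟩ := hx
      simp only [Finset.erase_right_comm (a := w) (b := v)]
      split_ifs
      · rcases lt_or_gt_of_ne hne with hlt | hlt
        · exact lt_case v hv w hw hlt
        · rw [add_comm]; exact lt_case w hw v hv hlt
      · simp
    · rintro ⟨v, w⟩ hx _ he
      simp only [Finset.mem_sigma, Finset.mem_erase] at hx
      exact hx.2.1 (by simpa using congrArg Sigma.fst he)
    · rintro ⟨v, w⟩ hx
      simp only [Finset.mem_sigma, Finset.mem_erase] at hx ⊢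
      exact ⟨hx.2.2, fun he => hx.2.1 he.symm, hx.1⟩
    · rintro ⟨v, w⟩ _
      rfl
  rw [boundary, boundary, ← Matrix.mulVecLin_mul, key, Matrix.mulVecLin_zero]

/-- Reduced integral homology `H̃_i(Δ) = ker ∂_i / im ∂_{i+1}`. -/
abbrev Homology (Δ : PreAbstractSimplicialComplex (Fin n)) (i : ℤ) : Type :=
  LinearMap.ker (boundary Δ i (i - 1)) ⧸
    (LinearMap.range (boundary Δ (i + 1) i)).submoduleOf (LinearMap.ker (boundary Δ i (i - 1)))

/-- The reduced Betti number: the rank of the abelian group `H̃_i(Δ)`. -/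
def betti (Δ : PreAbstractSimplicialComplex (Fin n)) (i : ℤ) : ℕ :=
  Module.finrank ℤ (Homology Δ i)

/-- The torsion subgroup `T(H̃_i(Δ))`. -/
def homologyTorsion (Δ : PreAbstractSimplicialComplex (Fin n)) (i : ℤ) :
    Submodule ℤ (Homology Δ i) :=
  Submodule.torsion ℤ (Homology Δ i)

/-! ### The dollar game -/

/-- The `i`-th up-down Laplacian `L_i = ∂_{i+1} ∂_{i+1}ᵗ`. -/
def laplacian (Δ : PreAbstractSimplicialComplex (Fin n)) (i : ℤ) : Chain Δ i →ₗ[ℤ] Chain Δ i :=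
  boundary Δ (i + 1) i ∘ₗ boundaryTranspose Δ (i + 1) i

/-- Linear equivalence of chains: `σ' = σ + L_i v` for some integral `v`. -/
def LinEquiv {Δ : PreAbstractSimplicialComplex (Fin n)} {i : ℤ} (σ σ' : Chain Δ i) : Prop :=
  ∃ v : Chain Δ i, σ' = σ + laplacian Δ i v

/-- A chain is winnable if it is linearly equivalent to an effective (nonnegative) chain. -/
def Winnable {Δ : PreAbstractSimplicialComplex (Fin n)} {i : ℤ} (σ : Chain Δ i) : Prop :=
  ∃ σ' : Chain Δ i, 0 ≤ σ' ∧ LinEquiv σ σ'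

/-! ### Degree -/

/-- The monoid `ker⁺ L_i` of nonnegative chains in the kernel of `L_i`. -/
def kerPlus (Δ : PreAbstractSimplicialComplex (Fin n)) (i : ℤ) : AddSubmonoid (Chain Δ i) where
  carrier := {τ | laplacian Δ i τ = 0 ∧ 0 ≤ τ}
  zero_mem' := ⟨map_zero _, le_refl _⟩
  add_mem' := by
    rintro a b ⟨ha, ha'⟩ ⟨hb, hb'⟩
    exact ⟨by rw [map_add, ha, hb, add_zero], add_nonneg ha' hb'⟩

/-- The Hilbert basis of `ker⁺ L_i`: the nonzero elements that are not the sum of two nonzero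
elements of the monoid. -/
def hilbertBasis (Δ : PreAbstractSimplicialComplex (Fin n)) (i : ℤ) : Set (Chain Δ i) :=
  {h | h ∈ kerPlus Δ i ∧ h ≠ 0 ∧
    ¬ ∃ y ∈ kerPlus Δ i, ∃ z ∈ kerPlus Δ i, y ≠ 0 ∧ z ≠ 0 ∧ h = y + z}

/-- The Hilbert basis generates `ker⁺ L_i` as a monoid. -/
theorem closure_hilbertBasis (Δ : PreAbstractSimplicialComplex (Fin n)) (i : ℤ) :
    AddSubmonoid.closure (hilbertBasis Δ i) = kerPlus Δ i := by
  refine le_antisymm (AddSubmonoid.closure_le.2 fun x hx => hx.1) ?_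
  have pos : ∀ y ∈ kerPlus Δ i, y ≠ 0 → 0 < ∑ f, y f := by
    intro y hy hne
    obtain ⟨f, hf⟩ := Function.ne_iff.1 hne
    exact Finset.sum_pos' (fun g _ => hy.2 g) ⟨f, Finset.mem_univ _, lt_of_le_of_ne (hy.2 f) hf.symm⟩
  have main : ∀ m : ℕ, ∀ x ∈ kerPlus Δ i, ∑ f, x f < m →
      x ∈ AddSubmonoid.closure (hilbertBasis Δ i) := by
    intro m
    induction m with
    | zero =>
      intro x hx hm
      exact absurd (Finset.sum_nonneg fun f _ => hx.2 f) (not_le.2 (by exact_mod_cast hm))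
    | succ m ih =>
      intro x hx hm
      by_cases h0 : x = 0
      · rw [h0]; exact zero_mem _
      by_cases hirr : ∃ y ∈ kerPlus Δ i, ∃ z ∈ kerPlus Δ i, y ≠ 0 ∧ z ≠ 0 ∧ x = y + z
      · obtain ⟨y, hy, z, hz, hy0, hz0, rfl⟩ := hirr
        have h1 := pos y hy hy0
        have h2 := pos z hz hz0
        simp only [Pi.add_apply, Finset.sum_add_distrib] at hm
        push_cast at hm
        exact add_mem (ih y hy (by linarith)) (ih z hz (by linarith))
      · exact AddSubmonoid.subset_closure ⟨hx, h0, hirr⟩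
  intro x hx
  refine main ((∑ f, x f).toNat + 1) x hx ?_
  have := Int.self_le_toNat (∑ f, x f)
  push_cast
  linarith

/-- The Hilbert basis is contained in every generating set of `ker⁺ L_i`. -/
theorem hilbertBasis_subset (Δ : PreAbstractSimplicialComplex (Fin n)) (i : ℤ)
    (S : Set (Chain Δ i)) (hS : AddSubmonoid.closure S = kerPlus Δ i) : hilbertBasis Δ i ⊆ S := by
  have main : ∀ x ∈ AddSubmonoid.closure S, x ∈ S ∨ x = 0 ∨
      ∃ y ∈ kerPlus Δ i, ∃ z ∈ kerPlus Δ i, y ≠ 0 ∧ z ≠ 0 ∧ x = y + z := by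
    intro x hx
    induction hx using AddSubmonoid.closure_induction with
    | mem x hx => exact Or.inl hx
    | zero => exact Or.inr (Or.inl rfl)
    | add x y hx hy ihx ihy =>
      by_cases hx0 : x = 0
      · simpa [hx0] using ihy
      by_cases hy0 : y = 0
      · simpa [hy0] using ihx
      exact Or.inr (Or.inr ⟨x, hS ▸ hx, y, hS ▸ hy, hx0, hy0, rfl⟩)
  intro h hh
  rcases main h (hS ▸ hh.1) with hs | h0 | hd
  · exact hs
  · exact absurd h0 hh.2.1
  · exact absurd hd hh.2.2

/-- The degree of an `i`-chain: the integer vector of its dot products with the elements of the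
Hilbert basis of `ker⁺ L_i` (the vector is indexed by the Hilbert basis itself). -/
def degree {Δ : PreAbstractSimplicialComplex (Fin n)} {i : ℤ} (σ : Chain Δ i) :
    hilbertBasis Δ i → ℤ :=
  fun h => ∑ f, σ f * h.1 f

/-! ### Forests -/

/-- `Υ` is a spanning `i`-forest of `Δ`. -/
structure IsSpanningForest (Δ : PreAbstractSimplicialComplex (Fin n)) (i : ℤ)
    (Υ : PreAbstractSimplicialComplex (Fin n)) : Prop where
  le : Υ ≤ Δ
  dim_eq : dim Υ = i
  skel_eq : skel Υ (i - 1) = skel Δ (i - 1)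
  homology_eq_zero : Subsingleton (Homology Υ i)
  betti_eq : betti Υ (i - 1) = betti Δ (i - 1)
  numFaces_eq : (numFaces Υ i : ℤ) = numFaces Δ i - betti (skel Δ i) i

open Classical in
/-- The `i`-forest number `τ_i(Δ) = ∑_Υ |T(H̃_{i-1}(Υ))|²`, summed over all spanning `i`-forests
`Υ` of `Δ`. -/
def forestNumber (Δ : PreAbstractSimplicialComplex (Fin n)) (i : ℤ) : ℕ :=
  ∑ Υ : PreAbstractSimplicialComplex (Fin n) with IsSpanningForest Δ i Υ,
    Nat.card (homologyTorsion Υ (i - 1)) ^ 2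

end DollarGame

end

/-!
The argument compares lattices. Let `M` be the matrix of `∂_i`, with `0 < i`, and `L = M Mᵗ`.

*Winnability.* The coboundary of a suitable `(i-2)`-cochain is a strictly positive vector in the
kernel of `Mᵗ` (`exists_pos_cocycle`). Adding multiples of it to arbitrary elements of
`ker L = ker Mᵗ` shows that the chains of degree `0` are exactly those orthogonal to `ker Mᵗ`
(`degree_eq_zero_iff`), and pairing with it shows that such a chain is winnable only by being
reduced to `0`. Hence all chains of degree `0` are winnable if and only if every integer vector
orthogonal to `ker Mᵗ` lies in the image of `M Mᵗ`.

By `forall_orthogonal_mem_range_iff`, this happens if and only if `M` is injective with saturated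
image. If it does happen, the image of `M` is clearly saturated, and `im (M Mᵗ) = im M` makes
`C_i` the orthogonal sum of `im Mᵗ` and `ker M`; a standard basis vector cannot be split into two
nonzero orthogonal integer vectors, and none lies in `ker M`, so `im Mᵗ` is everything and
`ker M = 0`. Conversely, an injective `M` with saturated image has an integral left inverse, which
solves the equations directly. No matrix-tree theorem is needed.

*Forests.* The spanning `i`-forests include one for each maximal set of `i`-faces with linearly
independent boundaries (`isSpanningForest_addFacets`). Each `i`-face has nonzero boundary and so
belongs to a forest; therefore a unique forest is the whole `i`-skeleton
(`forestNumber_eq_one_iff`). The skeleton is a forest if and only if `M` is injective, and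
`H̃_{i-1}` is torsion-free if and only if the image of `M` is saturated
(`homologyTorsion_eq_bot_iff`), which joins the two halves.
-/

namespace DollarGame

/-! ### Integer matrices -/

/-- An independent subfamily that is maximal among those containing a given nonzero vector. Over
`ℤ`, maximality only puts nonzero multiples of the other vectors into the span. -/
theorem exists_linearIndepOn_mem {ι E : Type*} [Finite ι] [AddCommGroup E]
    [Module.IsTorsionFree ℤ E] (v : ι → E) (i₀ : ι) (h : v i₀ ≠ 0) :
    ∃ s : Set ι, i₀ ∈ s ∧ LinearIndepOn ℤ v s ∧
      ∀ i ∉ s, ∃ a : ℤ, a ≠ 0 ∧ a • v i ∈ Submodule.span ℤ (v '' s) := by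
  have h1 : LinearIndepOn ℤ v {i₀} := LinearIndepOn.singleton h
  obtain ⟨s, hs, hmax⟩ :=
    (Set.toFinite {s : Set ι | LinearIndepOn ℤ v s}).exists_le_maximal (a := {i₀}) h1
  refine ⟨s, hs rfl, hmax.prop, fun i hi => ?_⟩
  by_contra! hc
  have hins : LinearIndepOn ℤ v (insert i s) :=
    hmax.prop.insert' fun r hr => by_contra fun hr0 => hc r hr0 hr
  exact hi (hmax.le_of_ge hins (Set.subset_insert i s) (Set.mem_insert i s))

theorem finrank_eq_of_forall_exists_smul_mem {E : Type*} [AddCommGroup E] [Module.Finite ℤ E]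
    {A B : Submodule ℤ E} (hAB : A ≤ B) (h : ∀ x ∈ B, ∃ a : ℤ, a ≠ 0 ∧ a • x ∈ A) :
    Module.finrank ℤ A = Module.finrank ℤ B := by
  have htors : Module.IsTorsion ℤ (B ⧸ A.submoduleOf B) := by
    intro x
    obtain ⟨⟨y, hy⟩, rfl⟩ := Submodule.Quotient.mk_surjective _ x
    obtain ⟨a, ha, hay⟩ := h y hy
    refine ⟨⟨a, mem_nonZeroDivisors_of_ne_zero ha⟩, ?_⟩
    rw [Submonoid.mk_smul, ← Submodule.Quotient.mk_smul, Submodule.Quotient.mk_eq_zero]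
    exact hay
  have h0 := htors.finrank_eq_zero
  have h1 := Submodule.finrank_quotient_add_finrank (A.submoduleOf B)
  rw [h0, zero_add, (Submodule.submoduleOfEquivOfLe hAB).finrank_eq] at h1
  exact h1

theorem finrank_span_eq_of_maximal {ι E : Type*} [AddCommGroup E] [Module.Finite ℤ E]
    (v : ι → E) (s : Set ι)
    (h : ∀ i ∉ s, ∃ a : ℤ, a ≠ 0 ∧ a • v i ∈ Submodule.span ℤ (v '' s)) :
    Module.finrank ℤ (Submodule.span ℤ (v '' s)) =
      Module.finrank ℤ (Submodule.span ℤ (Set.range v)) := by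
  refine finrank_eq_of_forall_exists_smul_mem
    (Submodule.span_mono (Set.image_subset_range v s)) fun x hx => ?_
  induction hx using Submodule.span_induction with
  | mem x hx =>
    obtain ⟨i, rfl⟩ := hx
    by_cases hi : i ∈ s
    · exact ⟨1, one_ne_zero, by
        rw [one_smul]; exact Submodule.subset_span (Set.mem_image_of_mem v hi)⟩
    · exact h i hi
  | zero => exact ⟨1, one_ne_zero, by simp⟩
  | add x y _ _ hx hy =>
    obtain ⟨a, ha, hax⟩ := hx
    obtain ⟨b, hb, hby⟩ := hy
    refine ⟨a * b, mul_ne_zero ha hb, ?_⟩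
    rw [smul_add]
    refine add_mem ?_ ?_
    · rw [mul_comm, mul_smul]
      exact Submodule.smul_mem _ b hax
    · rw [mul_smul]
      exact Submodule.smul_mem _ a hby
  | smul c x _ hx =>
    obtain ⟨a, ha, hax⟩ := hx
    exact ⟨a, ha, by rw [smul_comm]; exact Submodule.smul_mem _ c hax⟩

theorem finite_torsion (E : Type*) [AddCommGroup E] [Module.Finite ℤ E] :
    Finite (Submodule.torsion ℤ E) :=
  Module.finite_of_fg_torsion _ Submodule.torsion_isTorsion

/-- The lattice spanned by the columns of `M` is saturated: it contains every integer vector that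
has a nonzero multiple in it. -/
def Saturated {P Q : Type*} [Fintype Q] (M : Matrix P Q ℤ) : Prop :=
  ∀ (m : ℤ) (σ : P → ℤ), m ≠ 0 → (∃ x, M.mulVec x = m • σ) → ∃ x, M.mulVec x = σ

theorem saturated_iff_torsion_eq_bot {P Q : Type*} [Fintype Q] (M : Matrix P Q ℤ) :
    Saturated M ↔ Submodule.torsion ℤ ((P → ℤ) ⧸ LinearMap.range M.mulVecLin) = ⊥ := by
  rw [← Submodule.isTorsionFree_iff_torsion_eq_bot, Module.isTorsionFree_iff_smul_eq_zero]
  constructor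
  · intro h m x hx
    obtain ⟨σ, rfl⟩ := Submodule.Quotient.mk_surjective _ x
    by_cases hm : m = 0
    · exact Or.inl hm
    rw [← Submodule.Quotient.mk_smul, Submodule.Quotient.mk_eq_zero] at hx
    refine Or.inr ((Submodule.Quotient.mk_eq_zero _).2 ?_)
    exact h m σ hm hx
  · intro h m σ hm hx
    have h1 : m • (Submodule.Quotient.mk σ : (P → ℤ) ⧸ LinearMap.range M.mulVecLin) = 0 := by
      rw [← Submodule.Quotient.mk_smul, Submodule.Quotient.mk_eq_zero]
      exact hx
    have h2 := (h _ _ h1).resolve_left hm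
    rw [Submodule.Quotient.mk_eq_zero] at h2
    exact h2

/-- A saturated lattice is a direct summand, because its quotient is free. -/
theorem exists_leftInverse_of_saturated {P Q : Type*} [Fintype P] [Fintype Q] [DecidableEq P]
    [DecidableEq Q] {M : Matrix P Q ℤ} (hinj : Function.Injective M.mulVec)
    (hsat : Saturated M) : ∃ N : Matrix Q P ℤ, N * M = 1 := by
  have htf : Module.IsTorsionFree ℤ ((P → ℤ) ⧸ LinearMap.range M.mulVecLin) :=
    Submodule.isTorsionFree_iff_torsion_eq_bot.2 ((saturated_iff_torsion_eq_bot M).1 hsat)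
  have hfree : Module.Free ℤ ((P → ℤ) ⧸ LinearMap.range M.mulVecLin) := inferInstance
  obtain ⟨s, hs⟩ := Module.projective_lifting_property
    (LinearMap.range M.mulVecLin).mkQ LinearMap.id (Submodule.mkQ_surjective _)
  have hmem : ∀ σ, σ - s (Submodule.Quotient.mk σ) ∈ LinearMap.range M.mulVecLin := by
    intro σ
    rw [← Submodule.Quotient.mk_eq_zero, Submodule.Quotient.mk_sub, sub_eq_zero]
    exact (LinearMap.congr_fun hs (Submodule.Quotient.mk σ)).symm
  let e := LinearEquiv.ofInjective M.mulVecLin hinj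
  let p : (P → ℤ) →ₗ[ℤ] LinearMap.range M.mulVecLin :=
    (LinearMap.id - s ∘ₗ (LinearMap.range M.mulVecLin).mkQ).codRestrict _ hmem
  let N : (P → ℤ) →ₗ[ℤ] (Q → ℤ) := e.symm.toLinearMap ∘ₗ p
  refine ⟨LinearMap.toMatrix' N, ?_⟩
  apply Matrix.toLin'.injective
  rw [Matrix.toLin'_mul, Matrix.toLin'_toMatrix', Matrix.toLin'_one]
  refine LinearMap.ext fun x => ?_
  change e.symm (p (M.mulVec x)) = x
  rw [LinearEquiv.symm_apply_eq]
  apply Subtype.ext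
  change M.mulVec x - s (Submodule.Quotient.mk (M.mulVec x)) = M.mulVec x
  have : (Submodule.Quotient.mk (M.mulVec x) : (P → ℤ) ⧸ LinearMap.range M.mulVecLin) = 0 :=
    (Submodule.Quotient.mk_eq_zero _).2 ⟨x, rfl⟩
  rw [this, map_zero, sub_zero]

/-- The lattice-theoretic core: every integer vector orthogonal to `ker Mᵗ` lies in the image of
`M Mᵗ` exactly when the columns of `M` are independent and span a saturated lattice.

For the forward implication, `ℤ^Q` is the sum of `ker M` and `im Mᵗ`, which are orthogonal; a unit
vector cannot be a sum of two nonzero orthogonal integer vectors, so every unit vector is in one of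
the two, and it is not in `ker M`. -/
theorem forall_orthogonal_mem_range_iff {P Q : Type*} [Fintype P] [Fintype Q] [DecidableEq P]
    [DecidableEq Q] (M : Matrix P Q ℤ) (hcol : ∀ q, M.col q ≠ 0) :
    (∀ σ : P → ℤ, (∀ k, M.transpose.mulVec k = 0 → σ ⬝ᵥ k = 0) →
      ∃ v, M.mulVec (M.transpose.mulVec v) = σ) ↔
    Function.Injective M.mulVec ∧ Saturated M := by
  constructor
  · intro h
    have horth : ∀ (x : Q → ℤ) k, M.transpose.mulVec k = 0 → M.mulVec x ⬝ᵥ k = 0 := by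
      intro x k hk
      rw [dotProduct_comm, Matrix.dotProduct_mulVec, ← Matrix.mulVec_transpose, hk,
        zero_dotProduct]
    refine ⟨?_, fun m σ hm ⟨x, hx⟩ => ?_⟩
    · have hunit : ∀ q : Q, ∃ v, M.transpose.mulVec v = Pi.single q 1 := by
        intro q
        obtain ⟨v, hv⟩ := h (M.mulVec (Pi.single q 1)) (horth _)
        refine ⟨v, ?_⟩
        set a := M.transpose.mulVec v with ha
        set b := (Pi.single q 1 : Q → ℤ) - a with hb
        have hMb : M.mulVec b = 0 := by rw [hb, Matrix.mulVec_sub, hv, sub_self]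
        have hab : a ⬝ᵥ b = 0 := by
          rw [ha, Matrix.mulVec_transpose, ← Matrix.dotProduct_mulVec, hMb, dotProduct_zero]
        have hsum : a + b = Pi.single q 1 := by rw [hb]; abel
        have haa : a ⬝ᵥ a = a q := by
          have : a ⬝ᵥ (a + b) = a q := by rw [hsum, dotProduct_single_one]
          rwa [dotProduct_add, hab, add_zero] at this
        have hbb : b ⬝ᵥ b = b q := by
          have : b ⬝ᵥ (a + b) = b q := by rw [hsum, dotProduct_single_one]
          rwa [dotProduct_add, dotProduct_comm b a, hab, zero_add] at this
        have ha0 : 0 ≤ a q := haa ▸ Finset.sum_nonneg fun i _ => mul_self_nonneg (a i)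
        have hb0 : 0 ≤ b q := hbb ▸ Finset.sum_nonneg fun i _ => mul_self_nonneg (b i)
        have hq : a q + b q = 1 := by
          have := congrFun hsum q
          simpa using this
        have hcases : a q = 0 ∨ b q = 0 := by omega
        rcases hcases with h0 | h0
        · have : a = 0 := dotProduct_self_eq_zero.1 (haa.trans h0)
          rw [this, zero_add] at hsum
          rw [hsum, Matrix.mulVec_single_one] at hMb
          exact absurd hMb (hcol q)
        · have : b = 0 := dotProduct_self_eq_zero.1 (hbb.trans h0)
          rwa [this, add_zero] at hsum
      refine (injective_iff_map_eq_zero M.mulVecLin).2 fun x hx => funext fun q => ?_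
      obtain ⟨v, hv⟩ := hunit q
      have hx' : M.mulVec x = 0 := hx
      rw [Pi.zero_apply, ← dotProduct_single_one x q, ← hv, dotProduct_comm,
        Matrix.mulVec_transpose, ← Matrix.dotProduct_mulVec, hx', dotProduct_zero]
    · obtain ⟨v, hv⟩ := h σ fun k hk => by
        have h1 := horth x k hk
        rw [hx, smul_dotProduct, smul_eq_mul] at h1
        exact (mul_eq_zero.1 h1).resolve_left hm
      exact ⟨_, hv⟩
  · rintro ⟨hinj, hsat⟩ σ hσ
    obtain ⟨N, hN⟩ := exists_leftInverse_of_saturated hinj hsat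
    have hNt : M.transpose * N.transpose = 1 := by
      rw [← Matrix.transpose_mul, hN, Matrix.transpose_one]
    -- The projection `M N` fixes `σ`, since the image of its transposed complement is `ker Mᵗ`.
    have hfix : M.mulVec (N.mulVec σ) = σ := by
      refine dotProduct_eq _ _ fun y => ?_
      have h1 := hσ (y - N.transpose.mulVec (M.transpose.mulVec y)) (by
        rw [Matrix.mulVec_sub, Matrix.mulVec_mulVec, hNt, Matrix.one_mulVec, sub_self])
      rw [dotProduct_sub, sub_eq_zero] at h1
      rw [h1, Matrix.dotProduct_mulVec, Matrix.vecMul_transpose, Matrix.dotProduct_mulVec,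
        Matrix.vecMul_transpose]
    refine ⟨N.transpose.mulVec (N.mulVec σ), ?_⟩
    rw [Matrix.mulVec_mulVec _ M.transpose, hNt, Matrix.one_mulVec, hfix]

/-- Alternating sums of a positive decreasing sequence are positive. -/
theorem alternating_sum_pos {n : ℕ} (A : Fin n → ℤ) (hpos : ∀ v, 0 < A v) (hanti : StrictAnti A)
    (s : Finset (Fin n)) (hs : s.Nonempty) :
    0 < ∑ v ∈ s, (-1) ^ (s.filter (· < v)).card * A v := by
  have key : ∀ s : Finset (Fin n),
      0 ≤ ∑ v ∈ s, (-1) ^ (s.filter (· < v)).card * A v ∧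
      (s.Nonempty → 0 < ∑ v ∈ s, (-1) ^ (s.filter (· < v)).card * A v) ∧
      ∀ a, (∀ x ∈ s, a < x) → ∑ v ∈ s, (-1) ^ (s.filter (· < v)).card * A v < A a := by
    intro s
    induction s using Finset.induction_on_min with
    | empty => simp [hpos]
    | insert a s ha ih =>
      have hna : a ∉ s := fun h => lt_irrefl a (ha a h)
      have hsum : ∑ v ∈ insert a s, (-1) ^ ((insert a s).filter (· < v)).card * A v =
          A a - ∑ v ∈ s, (-1) ^ (s.filter (· < v)).card * A v := by
        rw [Finset.sum_insert hna, sub_eq_add_neg, ← Finset.sum_neg_distrib]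
        congr 1
        · have : (insert a s).filter (· < a) = ∅ := by
            refine Finset.filter_eq_empty_iff.2 fun x hx => ?_
            rcases Finset.mem_insert.1 hx with rfl | hx
            · exact lt_irrefl _
            · exact (ha x hx).not_gt
          rw [this, Finset.card_empty, pow_zero, one_mul]
        · refine Finset.sum_congr rfl fun v hv => ?_
          rw [Finset.filter_insert, if_pos (ha v hv), Finset.card_insert_of_notMem
            (fun h => hna (Finset.mem_of_mem_filter a h)), pow_succ]
          ring
      rw [hsum]
      have h1 := ih.2.2 a ha
      refine ⟨by linarith, fun _ => by linarith, fun b hb => ?_⟩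
      have h2 := hanti (hb a (Finset.mem_insert_self a s))
      have h3 := ih.1
      linarith
  exact (key s).2.1 hs

variable {n : ℕ}

/-! ### Boundary matrices and homology -/

theorem face_mem {Δ : PreAbstractSimplicialComplex (Fin n)} {i : ℤ} (hi : 0 ≤ i) (f : Face Δ i) :
    f.1 ∈ Δ := by
  rcases f.2.1 with h | h
  · exact h
  · have := f.2.2
    rw [h, Finset.card_empty] at this
    omega

theorem erase_mem_or_eq_empty {Δ : PreAbstractSimplicialComplex (Fin n)} {i : ℤ} (hi : 0 ≤ i)
    (f : Face Δ i) (v : Fin n) : f.1.erase v ∈ Δ ∨ f.1.erase v = ∅ := by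
  by_cases he : f.1.erase v = ∅
  · exact Or.inr he
  · exact Or.inl ((Δ.isRelLowerSet_faces (face_mem hi f)).2 (Finset.erase_subset _ _)
      (Finset.nonempty_iff_ne_empty.2 he))

theorem col_boundaryMatrix_ne_zero (Δ : PreAbstractSimplicialComplex (Fin n)) {i j : ℤ}
    (hi : 0 ≤ i) (hj : i = j + 1) (f : Face Δ i) : (boundaryMatrix Δ i j).col f ≠ 0 := by
  intro h0
  have hcard := f.2.2
  have hne : f.1.Nonempty := Finset.card_pos.1 (by omega)
  obtain ⟨v, hv⟩ := hne
  have hc := Finset.card_erase_add_one hv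
  have h1 := congrFun h0 ⟨f.1.erase v, erase_mem_or_eq_empty hi f v, by omega⟩
  change incidence (f.1.erase v) f.1 = 0 at h1
  rw [incidence, Finset.sum_eq_single v] at h1
  · simp at h1
  · intro w hw hwv
    exact if_neg fun he => hwv (Finset.erase_injOn f.1 hw hv he)
  · exact fun h => absurd hv h

theorem mulVec_boundaryMatrix_comp (Δ : PreAbstractSimplicialComplex (Fin n)) (i j k : ℤ)
    (x : Chain Δ i) : (boundaryMatrix Δ j k).mulVec ((boundaryMatrix Δ i j).mulVec x) = 0 :=
  LinearMap.congr_fun (boundary_comp_boundary Δ i j k) x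

theorem boundaryMatrix_mul (Δ : PreAbstractSimplicialComplex (Fin n)) (i j k : ℤ) :
    boundaryMatrix Δ j k * boundaryMatrix Δ i j = 0 := by
  classical
  apply Matrix.toLin'.injective
  rw [Matrix.toLin'_mul, map_zero]
  exact boundary_comp_boundary Δ i j k

/-- The torsion of `H̃_j` is that of `C_j / im ∂_{j+1}`, because `C_j / ker ∂_j` is torsion-free. -/
theorem homologyTorsion_eq_bot_iff (Δ : PreAbstractSimplicialComplex (Fin n)) {i j : ℤ}
    (h : i = j + 1) : homologyTorsion Δ j = ⊥ ↔ Saturated (boundaryMatrix Δ i j) := by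
  subst h
  rw [homologyTorsion, ← Submodule.isTorsionFree_iff_torsion_eq_bot,
    Module.isTorsionFree_iff_smul_eq_zero]
  constructor
  · intro h m σ hm ⟨x, hx⟩
    have hker : boundary Δ j (j - 1) σ = 0 := by
      have h1 : m • boundary Δ j (j - 1) σ = 0 := by
        rw [← map_smul, ← hx]
        exact mulVec_boundaryMatrix_comp Δ (j + 1) j (j - 1) x
      exact (smul_eq_zero.1 h1).resolve_left hm
    have h2 : m • (Submodule.Quotient.mk ⟨σ, hker⟩ : Homology Δ j) = 0 := by
      rw [← Submodule.Quotient.mk_smul, Submodule.Quotient.mk_eq_zero]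
      exact ⟨x, hx⟩
    have h3 := (h _ _ h2).resolve_left hm
    rw [Submodule.Quotient.mk_eq_zero] at h3
    exact h3
  · intro h m x hx
    obtain ⟨⟨σ, hσ⟩, rfl⟩ := Submodule.Quotient.mk_surjective _ x
    by_cases hm : m = 0
    · exact Or.inl hm
    rw [← Submodule.Quotient.mk_smul, Submodule.Quotient.mk_eq_zero] at hx
    exact Or.inr ((Submodule.Quotient.mk_eq_zero _).2 (h m σ hm hx))

theorem betti_add_rank_add_rank (Δ : PreAbstractSimplicialComplex (Fin n)) (j : ℤ) :
    betti Δ j + (boundaryMatrix Δ (j + 1) j).rank + (boundaryMatrix Δ j (j - 1)).rank =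
      numFaces Δ j := by
  have hle : LinearMap.range (boundary Δ (j + 1) j) ≤ LinearMap.ker (boundary Δ j (j - 1)) :=
    LinearMap.range_le_ker_iff.2 (boundary_comp_boundary Δ (j + 1) j (j - 1))
  have h1 := Submodule.finrank_quotient_add_finrank
    ((LinearMap.range (boundary Δ (j + 1) j)).submoduleOf (LinearMap.ker (boundary Δ j (j - 1))))
  rw [(Submodule.submoduleOfEquivOfLe hle).finrank_eq] at h1
  have h2 := Submodule.finrank_quotient_add_finrank (LinearMap.ker (boundary Δ j (j - 1)))
  rw [(boundary Δ j (j - 1)).quotKerEquivRange.finrank_eq, ← h1,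
    Module.finrank_fintype_fun_eq_card] at h2
  rw [numFaces, ← h2, add_comm]
  rfl

/-! ### Complexes with the same faces of a given dimension -/

/-- The identification of the `i`-faces of two complexes that have the same ones. -/
def faceEquiv {Υ Δ : PreAbstractSimplicialComplex (Fin n)} {i : ℤ}
    (h : ∀ s : Finset (Fin n), (s.card : ℤ) = i + 1 → (s ∈ Υ ↔ s ∈ Δ)) : Face Υ i ≃ Face Δ i :=
  Equiv.subtypeEquivRight fun s => by
    constructor
    · rintro ⟨h1, h2⟩
      exact ⟨h1.imp_left (h s h2).1, h2⟩
    · rintro ⟨h1, h2⟩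
      exact ⟨h1.imp_left (h s h2).2, h2⟩

theorem numFaces_congr {Υ Δ : PreAbstractSimplicialComplex (Fin n)} {i : ℤ}
    (h : ∀ s : Finset (Fin n), (s.card : ℤ) = i + 1 → (s ∈ Υ ↔ s ∈ Δ)) :
    numFaces Υ i = numFaces Δ i :=
  Fintype.card_congr (faceEquiv h)

theorem rank_boundaryMatrix_congr {Υ Δ : PreAbstractSimplicialComplex (Fin n)} {i j : ℤ}
    (hi : ∀ s : Finset (Fin n), (s.card : ℤ) = i + 1 → (s ∈ Υ ↔ s ∈ Δ))
    (hj : ∀ s : Finset (Fin n), (s.card : ℤ) = j + 1 → (s ∈ Υ ↔ s ∈ Δ)) :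
    (boundaryMatrix Υ i j).rank = (boundaryMatrix Δ i j).rank :=
  (boundaryMatrix Δ i j).rank_submatrix (faceEquiv hj) (faceEquiv hi)

theorem mulVec_boundaryMatrix_congr {Υ Δ : PreAbstractSimplicialComplex (Fin n)} {i j : ℤ}
    (hi : ∀ s : Finset (Fin n), (s.card : ℤ) = i + 1 → (s ∈ Υ ↔ s ∈ Δ))
    (hj : ∀ s : Finset (Fin n), (s.card : ℤ) = j + 1 → (s ∈ Υ ↔ s ∈ Δ)) (x : Chain Δ i) :
    (boundaryMatrix Υ i j).mulVec (x ∘ faceEquiv hi) =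
      (boundaryMatrix Δ i j).mulVec x ∘ faceEquiv hj := by
  have h1 := Matrix.submatrix_mulVec_equiv (boundaryMatrix Δ i j) (x ∘ faceEquiv hi)
    (faceEquiv hj) (faceEquiv hi)
  rw [Function.comp_assoc, Equiv.self_comp_symm, Function.comp_id] at h1
  exact h1

theorem injective_boundaryMatrix_congr {Υ Δ : PreAbstractSimplicialComplex (Fin n)} {i j : ℤ}
    (hi : ∀ s : Finset (Fin n), (s.card : ℤ) = i + 1 → (s ∈ Υ ↔ s ∈ Δ))
    (hj : ∀ s : Finset (Fin n), (s.card : ℤ) = j + 1 → (s ∈ Υ ↔ s ∈ Δ))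
    (h : Function.Injective (boundaryMatrix Υ i j).mulVec) :
    Function.Injective (boundaryMatrix Δ i j).mulVec := fun x y hxy => by
  have h1 : x ∘ faceEquiv hi = y ∘ faceEquiv hi := h (by
    rw [mulVec_boundaryMatrix_congr hi hj, mulVec_boundaryMatrix_congr hi hj, hxy])
  exact (faceEquiv hi).surjective.injective_comp_right h1

theorem saturated_boundaryMatrix_congr {Υ Δ : PreAbstractSimplicialComplex (Fin n)} {i j : ℤ}
    (hi : ∀ s : Finset (Fin n), (s.card : ℤ) = i + 1 → (s ∈ Υ ↔ s ∈ Δ))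
    (hj : ∀ s : Finset (Fin n), (s.card : ℤ) = j + 1 → (s ∈ Υ ↔ s ∈ Δ))
    (h : Saturated (boundaryMatrix Υ i j)) : Saturated (boundaryMatrix Δ i j) := by
  rintro m σ hm ⟨x, hx⟩
  obtain ⟨y, hy⟩ := h m (σ ∘ faceEquiv hj) hm ⟨x ∘ faceEquiv hi, by
    rw [mulVec_boundaryMatrix_congr hi hj, hx]; rfl⟩
  refine ⟨y ∘ (faceEquiv hi).symm, (faceEquiv hj).surjective.injective_comp_right ?_⟩
  change _ ∘ faceEquiv hj = σ ∘ faceEquiv hj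
  rw [← mulVec_boundaryMatrix_congr hi hj, Function.comp_assoc, Equiv.symm_comp_self,
    Function.comp_id, hy]

/-! ### Skeleta and dimension -/

theorem mem_skel {Δ : PreAbstractSimplicialComplex (Fin n)} {i : ℤ} {s : Finset (Fin n)} :
    s ∈ skel Δ i ↔ s ∈ Δ ∧ (s.card : ℤ) ≤ i + 1 :=
  Iff.rfl

theorem mem_skel_iff_of_card {Δ : PreAbstractSimplicialComplex (Fin n)} {i k : ℤ} (hk : k ≤ i)
    (s : Finset (Fin n)) (hs : (s.card : ℤ) = k + 1) : s ∈ skel Δ i ↔ s ∈ Δ := by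
  rw [mem_skel]
  exact and_iff_left (by omega)

theorem card_le_dim {Δ : PreAbstractSimplicialComplex (Fin n)} {s : Finset (Fin n)} (hs : s ∈ Δ) :
    (s.card : ℤ) ≤ dim Δ + 1 := by
  have h := Finset.le_sup (f := Finset.card) ((Set.toFinite Δ.faces).mem_toFinset.2 hs)
  rw [dim]
  omega

theorem neg_one_le_dim (Δ : PreAbstractSimplicialComplex (Fin n)) : -1 ≤ dim Δ := by
  rw [dim]
  omega

theorem dim_eq_of_card {Δ : PreAbstractSimplicialComplex (Fin n)} {i : ℤ} {s : Finset (Fin n)}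
    (hs : s ∈ Δ) (hcard : (s.card : ℤ) = i + 1) (hle : ∀ t ∈ Δ, (t.card : ℤ) ≤ i + 1) :
    dim Δ = i := by
  refine le_antisymm ?_ (by linarith [card_le_dim hs])
  have h : (Set.toFinite Δ.faces).toFinset.sup Finset.card ≤ s.card := Finset.sup_le fun t ht => by
    have := hle t ((Set.toFinite Δ.faces).mem_toFinset.1 ht)
    omega
  rw [dim]
  omega

theorem exists_mem_card_of_le_dim {Δ : PreAbstractSimplicialComplex (Fin n)} {i : ℤ} (hi : 0 ≤ i)
    (hdim : i ≤ dim Δ) : ∃ s ∈ Δ, (s.card : ℤ) = i + 1 := by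
  have hpos : 0 < (Set.toFinite Δ.faces).toFinset.sup Finset.card := by
    rw [dim] at hdim
    omega
  obtain ⟨t, ht, -⟩ := Finset.lt_sup_iff.1 hpos
  obtain ⟨t, ht, hsup⟩ := Finset.exists_mem_eq_sup _ ⟨t, ht⟩ Finset.card
  rw [dim, hsup] at hdim
  obtain ⟨s, hst, hs⟩ := Finset.exists_subset_card_eq (s := t) (n := (i + 1).toNat) (by omega)
  exact ⟨s, (Δ.isRelLowerSet_faces ((Set.toFinite Δ.faces).mem_toFinset.1 ht)).2 hst
    (Finset.card_pos.1 (by omega)), by omega⟩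

theorem isEmpty_face_of_dim_lt {Δ : PreAbstractSimplicialComplex (Fin n)} {i : ℤ} (hi : 0 ≤ i)
    (h : dim Δ < i) : IsEmpty (Face Δ i) := by
  refine ⟨fun ⟨s, hs, hc⟩ => ?_⟩
  rcases hs with hs | rfl
  · linarith [card_le_dim hs]
  · simp at hc
    omega

theorem rank_boundaryMatrix_of_isEmpty {Δ : PreAbstractSimplicialComplex (Fin n)} {i j : ℤ}
    [IsEmpty (Face Δ i)] : (boundaryMatrix Δ i j).rank = 0 :=
  Nat.le_zero.1 ((Matrix.rank_le_card_width _).trans (by simp))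

/-! ### Spanning forests -/

/-- The facets of a spanning forest have linearly independent boundaries. -/
theorem IsSpanningForest.injective {Δ Υ : PreAbstractSimplicialComplex (Fin n)} {i : ℤ}
    (h : IsSpanningForest Δ i Υ) : Function.Injective (boundaryMatrix Υ i (i - 1)).mulVec := by
  have hdim := h.dim_eq
  have := neg_one_le_dim Υ
  have : IsEmpty (Face Υ (i + 1)) := isEmpty_face_of_dim_lt (by omega) (by omega)
  refine (injective_iff_map_eq_zero (boundaryMatrix Υ i (i - 1)).mulVecLin).2 fun x hx => ?_
  have := h.homology_eq_zero
  have h1 : (Submodule.Quotient.mk ⟨x, hx⟩ : Homology Υ i) = 0 := Subsingleton.elim _ _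
  rw [Submodule.Quotient.mk_eq_zero] at h1
  obtain ⟨y, hy⟩ := h1
  rw [Subsingleton.elim y 0, map_zero] at hy
  exact hy.symm

/-- There is no spanning `(-1)`-forest, since `H̃_{-1}` of the complex without vertices is `ℤ`. -/
theorem IsSpanningForest.nonneg {Δ Υ : PreAbstractSimplicialComplex (Fin n)} {i : ℤ}
    (h : IsSpanningForest Δ i Υ) : 0 ≤ i := by
  by_contra hi
  have hdim := h.dim_eq
  have := neg_one_le_dim Υ
  obtain rfl : i = -1 := by omega
  have : IsEmpty (Face Υ (-1 - 1)) := ⟨fun s => by have := s.2.2; omega⟩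
  have h1 : (1 : Chain Υ (-1)) = 0 := h.injective (Subsingleton.elim _ _)
  exact one_ne_zero (congrFun h1 ⟨∅, Or.inr rfl, by simp⟩)

/-- The complex with all faces of `Δ` of dimension less than `i` and the `i`-faces in `B`. -/
def addFacets (Δ : PreAbstractSimplicialComplex (Fin n)) (i : ℤ) (B : Set (Face Δ i)) :
    PreAbstractSimplicialComplex (Fin n) where
  faces := {s | s ∈ Δ ∧ ((s.card : ℤ) ≤ i ∨ s ∈ Subtype.val '' B)}
  isRelLowerSet_faces := by
    rintro s ⟨hs, hc⟩
    refine ⟨(Δ.isRelLowerSet_faces hs).1, fun t hts ht => ?_⟩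
    refine ⟨(Δ.isRelLowerSet_faces hs).2 hts ht, ?_⟩
    have hle := Finset.card_le_card hts
    rcases hc with hc | ⟨f, hf, rfl⟩
    · exact Or.inl (by omega)
    · rcases hle.eq_or_lt with h | h
      · exact Or.inr ⟨f, hf, (Finset.eq_of_subset_of_card_le hts h.ge).symm⟩
      · have := f.2.2
        exact Or.inl (by omega)

theorem mem_addFacets {Δ : PreAbstractSimplicialComplex (Fin n)} {i : ℤ} {B : Set (Face Δ i)}
    {s : Finset (Fin n)} :
    s ∈ addFacets Δ i B ↔ s ∈ Δ ∧ ((s.card : ℤ) ≤ i ∨ s ∈ Subtype.val '' B) :=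
  Iff.rfl

theorem mem_addFacets_iff_of_card {Δ : PreAbstractSimplicialComplex (Fin n)} {i k : ℤ}
    {B : Set (Face Δ i)} (hk : k < i) (s : Finset (Fin n)) (hs : (s.card : ℤ) = k + 1) :
    s ∈ addFacets Δ i B ↔ s ∈ Δ := by
  rw [mem_addFacets]
  exact and_iff_left (Or.inl (by omega))

theorem val_mem_addFacets {Δ : PreAbstractSimplicialComplex (Fin n)} {i : ℤ} {B : Set (Face Δ i)}
    (hi : 0 ≤ i) {f : Face Δ i} (hf : f ∈ B) : f.1 ∈ addFacets Δ i B :=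
  ⟨face_mem hi f, Or.inr ⟨f, hf, rfl⟩⟩

/-- The `i`-faces of `addFacets Δ i B` are the elements of `B`. -/
def facetEquiv {Δ : PreAbstractSimplicialComplex (Fin n)} {i : ℤ} (hi : 0 ≤ i)
    (B : Set (Face Δ i)) : Face (addFacets Δ i B) i ≃ B where
  toFun f := ⟨⟨f.1, Or.inl (face_mem hi f).1, f.2.2⟩, by
    have h := f.2.2
    rcases (face_mem hi f).2 with hc | ⟨g, hg, hgf⟩
    · omega
    · rwa [← (Subtype.ext hgf : g = ⟨f.1, Or.inl (face_mem hi f).1, f.2.2⟩)]⟩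
  invFun f := ⟨f.1.1, Or.inl (val_mem_addFacets hi f.2), f.1.2.2⟩
  left_inv _ := rfl
  right_inv _ := rfl

/-- A maximal set of `i`-faces with linearly independent boundaries is the set of `i`-faces of a
spanning forest. -/
theorem isSpanningForest_addFacets {Δ : PreAbstractSimplicialComplex (Fin n)} {i : ℤ} (hi : 0 ≤ i)
    {B : Set (Face Δ i)} (hne : B.Nonempty)
    (hind : LinearIndepOn ℤ (boundaryMatrix Δ i (i - 1)).col B)
    (hmax : ∀ f ∉ B, ∃ a : ℤ, a ≠ 0 ∧ a • (boundaryMatrix Δ i (i - 1)).col f ∈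
      Submodule.span ℤ ((boundaryMatrix Δ i (i - 1)).col '' B)) :
    IsSpanningForest Δ i (addFacets Δ i B) := by
  have e1 := mem_addFacets_iff_of_card (B := B) (show i - 1 < i by omega)
  have e2 := mem_addFacets_iff_of_card (B := B) (show i - 1 - 1 < i by omega)
  have hfaces : numFaces (addFacets Δ i B) i = (boundaryMatrix Δ i (i - 1)).rank := by
    classical
    rw [Matrix.rank_eq_finrank_span_cols, ← finrank_span_eq_of_maximal _ B hmax,
      Set.image_eq_range, finrank_span_eq_card hind]
    exact Fintype.card_congr (facetEquiv hi B)
  have hinj : Function.Injective (boundaryMatrix (addFacets Δ i B) i (i - 1)).mulVec := by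
    rw [Matrix.mulVec_injective_iff]
    exact (hind.comp _ (facetEquiv hi B).injective).map' (LinearEquiv.funCongrLeft ℤ ℤ
      (faceEquiv e1)).toLinearMap (LinearEquiv.ker _)
  have hrank : (boundaryMatrix (addFacets Δ i B) i (i - 1)).rank =
      (boundaryMatrix Δ i (i - 1)).rank := by
    rw [← hfaces, Matrix.rank_eq_finrank_span_cols,
      finrank_span_eq_card (Matrix.mulVec_injective_iff.1 hinj), numFaces]
  obtain ⟨f₀, hf₀⟩ := hne
  refine ⟨fun s hs => hs.1, ?_, ?_, ?_, ?_, ?_⟩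
  · refine dim_eq_of_card (val_mem_addFacets hi hf₀) f₀.2.2 fun t ht => ?_
    rcases ht.2 with h | ⟨g, -, rfl⟩
    · omega
    · exact g.2.2.le
  · ext s
    change s ∈ skel _ _ ↔ s ∈ skel _ _
    rw [mem_skel, mem_skel, mem_addFacets]
    constructor
    · exact fun h => ⟨h.1.1, h.2⟩
    · exact fun h => ⟨⟨h.1, Or.inl (by omega)⟩, h.2⟩
  · refine ⟨fun x y => ?_⟩
    obtain ⟨⟨x, hx⟩, rfl⟩ := Submodule.Quotient.mk_surjective _ x
    obtain ⟨⟨y, hy⟩, rfl⟩ := Submodule.Quotient.mk_surjective _ y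
    congr 2
    exact hinj (hx.trans hy.symm)
  · have h1 := betti_add_rank_add_rank (addFacets Δ i B) (i - 1)
    have h2 := betti_add_rank_add_rank Δ (i - 1)
    rw [sub_add_cancel, rank_boundaryMatrix_congr e1 e2, numFaces_congr e1] at h1
    rw [sub_add_cancel] at h2
    omega
  · have h1 := betti_add_rank_add_rank (skel Δ i) i
    have : IsEmpty (Face (skel Δ i) (i + 1)) := ⟨fun f => by
      have := (face_mem (by omega) f).2
      have := f.2.2
      omega⟩
    rw [rank_boundaryMatrix_of_isEmpty, numFaces_congr (mem_skel_iff_of_card le_rfl),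
      rank_boundaryMatrix_congr (mem_skel_iff_of_card le_rfl)
        (mem_skel_iff_of_card (by omega))] at h1
    omega

/-- The boundary of an `i`-face with `0 ≤ i` is nonzero, so every such face is in a maximal
independent set. -/
theorem exists_isSpanningForest_mem {Δ : PreAbstractSimplicialComplex (Fin n)} {i : ℤ}
    (hi : 0 ≤ i) (f : Face Δ i) : ∃ Υ, IsSpanningForest Δ i Υ ∧ f.1 ∈ Υ := by
  obtain ⟨B, hf, hind, hmax⟩ := exists_linearIndepOn_mem (boundaryMatrix Δ i (i - 1)).col f
    (col_boundaryMatrix_ne_zero Δ hi (by omega) f)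
  exact ⟨_, isSpanningForest_addFacets hi ⟨f, hf⟩ hind hmax, val_mem_addFacets hi hf⟩

theorem IsSpanningForest.eq_skel {Δ Υ : PreAbstractSimplicialComplex (Fin n)} {i : ℤ}
    (h : IsSpanningForest Δ i Υ) (hall : ∀ f : Face Δ i, f.1 ∈ Υ) : Υ = skel Δ i := by
  ext s
  change s ∈ Υ ↔ s ∈ skel Δ i
  rw [mem_skel]
  constructor
  · exact fun hs => ⟨h.le hs, h.dim_eq ▸ card_le_dim hs⟩
  · rintro ⟨hs, hc⟩
    rcases hc.eq_or_lt with hc | hc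
    · exact hall ⟨s, Or.inl hs, hc⟩
    · have h1 : s ∈ skel Δ (i - 1) := ⟨hs, by omega⟩
      rw [← h.skel_eq] at h1
      exact h1.1

theorem isSpanningForest_skel_iff {Δ : PreAbstractSimplicialComplex (Fin n)} {i : ℤ} (hi : 0 ≤ i)
    (hdim : i ≤ dim Δ) : IsSpanningForest Δ i (skel Δ i) ↔
      Function.Injective (boundaryMatrix Δ i (i - 1)).mulVec := by
  constructor
  · exact fun h => injective_boundaryMatrix_congr (mem_skel_iff_of_card le_rfl)
      (mem_skel_iff_of_card (by omega)) h.injective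
  · intro h
    obtain ⟨s, hs, hc⟩ := exists_mem_card_of_le_dim hi hdim
    have h1 : IsSpanningForest Δ i (addFacets Δ i Set.univ) :=
      isSpanningForest_addFacets hi ⟨⟨s, Or.inl hs, hc⟩, trivial⟩
        (linearIndepOn_univ_iff.2 (Matrix.mulVec_injective_iff.1 h)) fun f hf => absurd trivial hf
    rwa [h1.eq_skel fun f => val_mem_addFacets hi trivial] at h1

theorem homologyTorsion_skel_eq_bot_iff (Δ : PreAbstractSimplicialComplex (Fin n)) (i : ℤ) :
    homologyTorsion (skel Δ i) (i - 1) = ⊥ ↔ homologyTorsion Δ (i - 1) = ⊥ := by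
  rw [homologyTorsion_eq_bot_iff _ (show i = i - 1 + 1 by omega),
    homologyTorsion_eq_bot_iff _ (show i = i - 1 + 1 by omega)]
  have h1 := mem_skel_iff_of_card (Δ := Δ) (le_refl i)
  have h2 := mem_skel_iff_of_card (Δ := Δ) (show i - 1 ≤ i by omega)
  exact ⟨saturated_boundaryMatrix_congr h1 h2,
    saturated_boundaryMatrix_congr (fun s hs => (h1 s hs).symm) fun s hs => (h2 s hs).symm⟩

instance (Δ : PreAbstractSimplicialComplex (Fin n)) (i : ℤ) : Finite (homologyTorsion Δ i) :=
  have _ : Module.Finite ℤ (Homology Δ i) := Module.Finite.quotient ℤ _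
  finite_torsion (Homology Δ i)

/-- As every `i`-face lies in some spanning forest, a unique spanning forest contains them all. -/
theorem forestNumber_eq_one_iff (Δ : PreAbstractSimplicialComplex (Fin n)) (i : ℤ) :
    forestNumber Δ i = 1 ↔
      IsSpanningForest Δ i (skel Δ i) ∧ homologyTorsion Δ (i - 1) = ⊥ := by
  classical
  rw [← homologyTorsion_skel_eq_bot_iff]
  have hpos : ∀ Υ : PreAbstractSimplicialComplex (Fin n),
      1 ≤ Nat.card (homologyTorsion Υ (i - 1)) ^ 2 := fun Υ =>
    Nat.one_le_pow _ _ Nat.card_pos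
  constructor
  · intro h
    rw [forestNumber] at h
    obtain ⟨Υ, hΥ⟩ := Finset.nonempty_of_ne_empty (s := Finset.univ.filter
      (IsSpanningForest Δ i)) (by rintro h0; simp [h0] at h)
    -- Every term of the sum is at least `1`, so there is only one forest.
    have hcard : (Finset.univ.filter (IsSpanningForest Δ i)).card ≤ 1 := by
      rw [← h, Finset.card_eq_sum_ones]
      exact Finset.sum_le_sum fun Υ _ => hpos Υ
    have hF := (Finset.mem_filter.1 hΥ).2
    have hskel : Υ = skel Δ i := hF.eq_skel fun f => by
      obtain ⟨Υ', hF', hf⟩ := exists_isSpanningForest_mem hF.nonneg f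
      rwa [Finset.card_le_one.1 hcard Υ hΥ Υ' (by simp [hF'])]
    subst hskel
    refine ⟨hF, ?_⟩
    have h1 := Finset.single_le_sum (f := fun Υ : PreAbstractSimplicialComplex (Fin n) =>
      Nat.card (homologyTorsion Υ (i - 1)) ^ 2) (fun Υ _ => Nat.zero_le _) hΥ
    have h2 : Nat.card (homologyTorsion (skel Δ i) (i - 1)) = 1 :=
      (Nat.pow_eq_one.1 (le_antisymm (h1.trans_eq (by convert h)) (hpos _))).resolve_right
        two_ne_zero
    have h3 := (Nat.card_eq_one_iff_unique.1 h2).1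
    exact Submodule.eq_bot_of_subsingleton
  · rintro ⟨hF, ht⟩
    have hunique : Finset.univ.filter (IsSpanningForest Δ i) = {skel Δ i} := by
      ext Υ
      rw [Finset.mem_filter, Finset.mem_singleton]
      refine ⟨fun ⟨_, h⟩ => h.eq_skel fun f => ?_, by rintro rfl; exact ⟨Finset.mem_univ _, hF⟩⟩
      let incl : Face Υ i → Face Δ i := fun g => ⟨g.1, g.2.1.imp_left fun hg => h.le hg, g.2.2⟩
      have hinj : Function.Injective incl := fun a b hab =>
        Subtype.ext (congrArg (fun f : Face Δ i => f.1) hab)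
      have hcard : Fintype.card (Face Υ i) = Fintype.card (Face Δ i) := by
        have h1 := h.numFaces_eq
        have h2 := hF.numFaces_eq
        rw [numFaces_congr (mem_skel_iff_of_card le_rfl)] at h2
        change numFaces Υ i = numFaces Δ i
        omega
      obtain ⟨g, rfl⟩ := ((Fintype.bijective_iff_injective_and_card incl).2 ⟨hinj, hcard⟩).2 f
      exact face_mem hF.nonneg g
    rw [forestNumber]
    have : ∑ Υ ∈ Finset.univ.filter (IsSpanningForest Δ i),
        Nat.card (homologyTorsion Υ (i - 1)) ^ 2 = 1 := by
      rw [hunique, Finset.sum_singleton, ht, Nat.card_eq_one_iff_unique.2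
        ⟨inferInstance, inferInstance⟩, one_pow]
    convert this

/-! ### The dollar game -/

/-- The coboundary of the cochain `g ↦ n + ∑_{w ∈ g} w` is positive on each face
`v₀ < v₁ < ⋯`, since its value is an alternating sum of a decreasing sequence. -/
theorem exists_pos_cocycle (Δ : PreAbstractSimplicialComplex (Fin n)) (i : ℤ) {j : ℤ}
    (hj : 0 ≤ j) : ∃ p : Chain Δ j, (boundaryMatrix Δ i j).transpose.mulVec p = 0 ∧
      ∀ f, 0 < p f := by
  let α : Finset (Fin n) → ℤ := fun g => n + ∑ w ∈ g, (w : ℤ)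
  refine ⟨(boundaryMatrix Δ j (j - 1)).transpose.mulVec fun g => α g.1, ?_, fun f => ?_⟩
  · rw [Matrix.mulVec_mulVec, ← Matrix.transpose_mul, boundaryMatrix_mul, Matrix.transpose_zero,
      Matrix.zero_mulVec]
  have hne : f.1.Nonempty := Finset.card_pos.1 (by have := f.2.2; omega)
  have h1 : (boundaryMatrix Δ j (j - 1)).transpose.mulVec (fun g => α g.1) f =
      ∑ v ∈ f.1, (-1) ^ (f.1.filter (· < v)).card * (n + ∑ w ∈ f.1, (w : ℤ) - v) := by
    change ∑ g : Face Δ (j - 1), incidence g.1 f.1 * α g.1 = _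
    simp only [incidence, Finset.sum_mul]
    rw [Finset.sum_comm]
    refine Finset.sum_congr rfl fun v hv => ?_
    have hc := Finset.card_erase_add_one hv
    have hfc := f.2.2
    rw [Finset.sum_eq_single ⟨f.1.erase v, erase_mem_or_eq_empty hj f v, by omega⟩]
    · rw [if_pos rfl]
      have := Finset.sum_erase_add f.1 (fun w : Fin n => (w : ℤ)) hv
      simp only [α]
      rw [← this]
      ring
    · intro g _ hg
      rw [if_neg fun he => hg (Subtype.ext he.symm), zero_mul]
    · simp
  rw [h1]
  refine alternating_sum_pos _ (fun v => ?_) (fun v w hvw => ?_) f.1 hne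
  · have h2 : (v : ℤ) < n := by exact_mod_cast v.2
    have h3 : 0 ≤ ∑ w ∈ f.1, (w : ℤ) := Finset.sum_nonneg fun w _ => by positivity
    linarith
  · have : (v : ℤ) < w := by exact_mod_cast hvw
    change _ - _ < _ - _
    linarith

theorem laplacian_eq_zero_iff {Δ : PreAbstractSimplicialComplex (Fin n)} {j : ℤ} (k : Chain Δ j) :
    laplacian Δ j k = 0 ↔ (boundaryMatrix Δ (j + 1) j).transpose.mulVec k = 0 := by
  constructor
  · intro h
    refine dotProduct_self_eq_zero.1 ?_
    have h1 : (boundaryMatrix Δ (j + 1) j).mulVec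
        ((boundaryMatrix Δ (j + 1) j).transpose.mulVec k) = 0 := h
    conv_lhs => rw [Matrix.mulVec_transpose (boundaryMatrix Δ (j + 1) j) k]
    rw [← Matrix.dotProduct_mulVec, ← Matrix.mulVec_transpose, h1, dotProduct_zero]
  · intro h
    change (boundaryMatrix Δ (j + 1) j).mulVec
      ((boundaryMatrix Δ (j + 1) j).transpose.mulVec k) = 0
    rw [h, Matrix.mulVec_zero]

/-- A chain of degree `0` is orthogonal to `ker⁺ L_j`, and a positive cocycle makes `ker⁺ L_j`
span `ker L_j`, which is the kernel of the transposed boundary map. -/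
theorem degree_eq_zero_iff {Δ : PreAbstractSimplicialComplex (Fin n)} {j : ℤ} (hj : 0 ≤ j)
    (σ : Chain Δ j) : degree σ = 0 ↔
      ∀ k, (boundaryMatrix Δ (j + 1) j).transpose.mulVec k = 0 → σ ⬝ᵥ k = 0 := by
  constructor
  · intro h
    have hplus : ∀ k ∈ kerPlus Δ j, σ ⬝ᵥ k = 0 := by
      intro k hk
      rw [← closure_hilbertBasis] at hk
      induction hk using AddSubmonoid.closure_induction with
      | mem x hx => exact congrFun h ⟨x, hx⟩
      | zero => exact dotProduct_zero σ
      | add x y _ _ hx hy => rw [dotProduct_add, hx, hy, add_zero]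
    obtain ⟨p, hp, hpos⟩ := exists_pos_cocycle Δ (j + 1) hj
    have hσp : σ ⬝ᵥ p = 0 := hplus p ⟨(laplacian_eq_zero_iff p).2 hp, fun f => (hpos f).le⟩
    intro k hk
    -- A large multiple of `p` makes `k` nonnegative.
    have hsum : σ ⬝ᵥ (k + (∑ f, |k f|) • p) = 0 := by
      refine hplus _ ⟨(laplacian_eq_zero_iff _).2 ?_, fun f => ?_⟩
      · rw [Matrix.mulVec_add, Matrix.mulVec_smul, hk, hp, smul_zero, add_zero]
      · have h1 : |k f| ≤ ∑ f, |k f| :=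
          Finset.single_le_sum (f := fun f => |k f|) (fun f _ => abs_nonneg (k f))
            (Finset.mem_univ f)
        have h2 := neg_abs_le (k f)
        have h3 := hpos f
        have h4 := abs_nonneg (k f)
        change 0 ≤ k f + (∑ f, |k f|) * p f
        nlinarith
    rwa [dotProduct_add, dotProduct_smul, hσp, smul_zero, add_zero] at hsum
  · intro h
    funext k
    exact h k.1 ((laplacian_eq_zero_iff k.1).1 k.2.1.1)

/-- A positive cocycle pairs to zero with every effective chain linearly equivalent to a chain of
degree `0`, so such an effective chain vanishes. -/
theorem winnable_iff_of_degree_eq_zero {Δ : PreAbstractSimplicialComplex (Fin n)} {j : ℤ}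
    (hj : 0 ≤ j) {σ : Chain Δ j} (hσ : degree σ = 0) :
    Winnable σ ↔ ∃ v, laplacian Δ j v = σ := by
  constructor
  · rintro ⟨σ', hσ', v, rfl⟩
    obtain ⟨p, hp, hpos⟩ := exists_pos_cocycle Δ (j + 1) hj
    have h1 : laplacian Δ j v ⬝ᵥ p = 0 := by
      change (boundaryMatrix Δ (j + 1) j).mulVec _ ⬝ᵥ p = 0
      rw [dotProduct_comm, Matrix.dotProduct_mulVec, ← Matrix.mulVec_transpose, hp,
        zero_dotProduct]
    have h2 : (σ + laplacian Δ j v) ⬝ᵥ p = 0 := by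
      rw [add_dotProduct, h1, (degree_eq_zero_iff hj σ).1 hσ p hp, add_zero]
    have h3 := (Finset.sum_eq_zero_iff_of_nonneg fun f _ =>
      mul_nonneg (hσ' f) (hpos f).le).1 h2
    refine ⟨-v, ?_⟩
    have h4 : σ + laplacian Δ j v = 0 := funext fun f =>
      (mul_eq_zero.1 (h3 f (Finset.mem_univ f))).resolve_right (hpos f).ne'
    rw [map_neg, neg_eq_iff_add_eq_zero, add_comm, h4]
  · rintro ⟨v, rfl⟩
    exact ⟨0, le_rfl, -v, by rw [map_neg, add_neg_cancel]⟩

theorem forall_winnable_iff {Δ : PreAbstractSimplicialComplex (Fin n)} {j : ℤ} (hj : 0 ≤ j) :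
    (∀ σ : Chain Δ j, degree σ = 0 → Winnable σ) ↔
      Function.Injective (boundaryMatrix Δ (j + 1) j).mulVec ∧
        Saturated (boundaryMatrix Δ (j + 1) j) := by
  classical
  rw [← forall_orthogonal_mem_range_iff _ fun f =>
    col_boundaryMatrix_ne_zero Δ (show 0 ≤ j + 1 by omega) rfl f]
  refine forall_congr' fun σ => ?_
  rw [← degree_eq_zero_iff hj]
  exact forall_congr' fun hσ => winnable_iff_of_degree_eq_zero hj hσ

end DollarGame

theorem mainTheorem2 {n : ℕ} (Δ : PreAbstractSimplicialComplex (Fin n)) (i : ℤ) :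
    (1 ≤ i → i ≤ DollarGame.dim Δ →
      ((∀ σ : DollarGame.Chain Δ (i - 1), DollarGame.degree σ = 0 → DollarGame.Winnable σ) ↔
        DollarGame.forestNumber Δ i = 1)) ∧
    (DollarGame.forestNumber Δ i = 1 ↔
      DollarGame.IsSpanningForest Δ i (DollarGame.skel Δ i) ∧
        DollarGame.homologyTorsion Δ (i - 1) = ⊥) := by
  refine ⟨fun hi hdim => ?_, DollarGame.forestNumber_eq_one_iff Δ i⟩
  rw [DollarGame.forestNumber_eq_one_iff, DollarGame.forall_winnable_iff (by omega),
    DollarGame.isSpanningForest_skel_iff (by omega) hdim,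
    DollarGame.homologyTorsion_eq_bot_iff Δ (show i = i - 1 + 1 by omega), sub_add_cancel]
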